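/- **Conventions.** A *Markov category* is a symmetric monoidal category in which every object $A$ carries a distinguished cocommutative comonoid structure (duplicate $\delta_A : A \to A\otimes A$, discard $\epsilon_A : A \to \mathbf I$), compatible with $\otimes$ and $\mathbf I$, such that the discards are natural. It is *straight* if it is strict and the monoid $(\mathcal M_0,\otimes,\mathbf I)$ of its objects has no idempotents and no elements of finite order other than $\mathbf I$. A *strict Markov functor* is a symmetric monoidal functor whose structure isomorphisms are identities and which preserves duplicates and discards. For an object $w$ and $m \ge 0$, $\iota_{w\to w^m} : w \to w^{\otimes m}$ denotes the multiplier, i.e. the $m$-fold iterated duplicate (the discard for $m=0$, the identity for $m=1$). **Effects.** Let $\mathcal M$ be a straight Markov category, $W=(w_1,\dots,w_n)$ a sequence of objects with $w_i\neq\mathbf I$ for all $i$, and for $S\subseteq\{1,\dots,n\}$ let $w_S=\bigotimes_{i\in S}w_i$ (in increasing order, $w_\emptyset=\mathbf I$). Let $K$ consist of morphisms $\kappa_i : w_{S_i}\to w_i$, one for each $i$, such that the directed graph $G$ on $\{1,\dots,n\}$ with an arrow $j\to i$ if and only if $j\in S_i$ has no directed cycles (in particular $i\notin S_i$). For $S,T\subseteq\{1,\dots,n\}$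 let $G_{S\to T}$ be the subgraph of $G$ consisting of the vertices in $S\cup T$ and of all directed paths that end in $T$ and do not pass through or end in $S$ (they may start in $S$). For every vertex $i$ of $G_{S\to T}$ let $m_i$ be the number of children of $i$ in $G_{S\to T}$, plus $1$ if $i\in T$, and let $\Gamma_i$ be the string diagram of $\iota_{w_i\to w_i^{m_i}}$ if $i\in S$, and of $\iota_{w_i\to w_i^{m_i}}\circ\kappa_i$ if $i\notin S$. Connect these diagrams by joining, for each arrow $j\to i$ of $G_{S\to T}$, one output of $\Gamma_j$ to the input $w_j$ of $\Gamma_i$; for every $t\in T$ one output $w_t$ of $\Gamma_t$ remains free. The resulting diagram has domain $w_S$ and codomain $w_T$, and the morphism $w_S\to w_T$ of $\mathcal M$ that it represents is the *$(W,K)$-effect* $[T\,\|\,S]_{(W,K)}$ of $w_S$ on $w_T$. **Proposition 5.1.** Let $\mathcal M$, $\mathcal N$ be straight Markov categories and $F:\mathcal M\to\mathcal N$ a strict Markov functor. Then for all $(W,K)$ in $\mathcal M$ as above and all $S,T\subseteq\{1,\dots,n\}$, $$F\bigl([T\,\|\,S]_{(W,K)}\bigr)=[T\,\|\,S]_{(F(W),F(K))},$$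 where $F(W)=(F(w_1),\dots,F(w_n))$ and $F(K)=\{F(\kappa_1),\dots,F(\kappa_n)\}$, with $F(\kappa_i):F(w)_{S_i}\to F(w_i)$. (If some $F(w_i)=\mathbf I$, the right-hand side is understood by the same construction.) -/

import Mathlib

open CategoryTheory MonoidalCategory ComonObj

universe v v₁ v₂ u u₁ u₂

noncomputable section

namespace MarkovEffect

/-! ### Strict and straight Markov categories, strict Markov functors -/

/-- Monoidal product of a list of objects (the unit for the empty list). -/
def tensorList {C : Type u} [Category.{v} C] [MonoidalCategory.{v} C] : List C → C
  | [] => 𝟙_ C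
  | X :: l => X ⊗ tensorList l

/-- The monoidal power `w ⊗ ⋯ ⊗ w` with `m` factors; `tensorPow w 0` is the unit. -/
def tensorPow {C : Type u} [Category.{v} C] [MonoidalCategory.{v} C] (w : C) (m : ℕ) : C :=
  tensorList (List.replicate m w)

/-- A monoidal category is strict if its associators and unitors are identities. -/
structure IsStrictMonoidal (C : Type u) [Category.{v} C] [MonoidalCategory.{v} C] : Prop where
  tensor_assoc : ∀ X Y Z : C, (X ⊗ Y) ⊗ Z = X ⊗ (Y ⊗ Z)
  unit_tensor : ∀ X : C, 𝟙_ C ⊗ X = X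
  tensor_unit : ∀ X : C, X ⊗ 𝟙_ C = X
  associator_eq : ∀ X Y Z : C, (α_ X Y Z).hom = eqToHom (tensor_assoc X Y Z)
  leftUnitor_eq : ∀ X : C, (λ_ X).hom = eqToHom (unit_tensor X)
  rightUnitor_eq : ∀ X : C, (ρ_ X).hom = eqToHom (tensor_unit X)

/-- A Markov category is straight if it is strict and its monoid of objects has no idempotents
and no elements of finite order other than the unit. -/
structure IsStraight (C : Type u) [Category.{v} C] [MonoidalCategory.{v} C]
    [MarkovCategory C] : Prop where
  strict : IsStrictMonoidal C
  eq_unit_of_idempotent : ∀ w : C, w ⊗ w = w → w = 𝟙_ C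
  eq_unit_of_finite_order : ∀ (w : C) (m : ℕ), 0 < m → tensorPow w m = 𝟙_ C → w = 𝟙_ C

/-- A strict Markov functor: a strong symmetric monoidal functor (`F.Braided`) whose structure
isomorphisms are identities and which preserves the duplicates and the discards. -/
structure IsStrictMarkovFunctor {C : Type u₁} [Category.{v₁} C] [MonoidalCategory.{v₁} C]
    [MarkovCategory C] {D : Type u₂} [Category.{v₂} D] [MonoidalCategory.{v₂} D]
    [MarkovCategory D] (F : C ⥤ D) [F.Braided] : Prop where
  obj_unit : F.obj (𝟙_ C) = 𝟙_ D
  obj_tensor : ∀ X Y : C, F.obj (X ⊗ Y) = F.obj X ⊗ F.obj Y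
  ε_eq : Functor.LaxMonoidal.ε F = eqToHom obj_unit.symm
  μ_eq : ∀ X Y : C, Functor.LaxMonoidal.μ F X Y = eqToHom (obj_tensor X Y).symm
  map_copy : ∀ X : C, Δ[F.obj X] ≫ Functor.LaxMonoidal.μ F X X = F.map Δ[X]
  map_discard : ∀ X : C, ε[F.obj X] ≫ Functor.LaxMonoidal.ε F = F.map ε[X]

/-! ### Multipliers -/

/-- Multipliers on a single object `w`: the morphisms generated, under composition and monoidal
product, from the duplicate, the discard, the symmetry and the identity on `w`. The constructor
`cast` only replaces the source and the target by equal objects. -/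
inductive IsMultiplier {C : Type u} [Category.{v} C] [MonoidalCategory.{v} C] [MarkovCategory C]
    (w : C) : ∀ {X Y : C}, (X ⟶ Y) → Prop
  | identity : IsMultiplier w (𝟙 w)
  | duplicate : IsMultiplier w Δ[w]
  | discard : IsMultiplier w ε[w]
  | symmetry : IsMultiplier w (β_ w w).hom
  | comp {X Y Z : C} {f : X ⟶ Y} {g : Y ⟶ Z} :
      IsMultiplier w f → IsMultiplier w g → IsMultiplier w (f ≫ g)
  | tensor {X X' Y Y' : C} {f : X ⟶ Y} {g : X' ⟶ Y'} :
      IsMultiplier w f → IsMultiplier w g → IsMultiplier w (f ⊗ₘ g)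
  | cast {X X' Y Y' : C} {f : X ⟶ Y} (hX : X' = X) (hY : Y = Y') :
      IsMultiplier w f → IsMultiplier w (eqToHom hX ≫ f ≫ eqToHom hY)

/-- The multiplier `w ⟶ w ⊗ ⋯ ⊗ w` (with `m` factors): the discard for `m = 0`, the identity for
`m = 1` (by counitality), and the iterated duplicate in general. In a straight Markov category it
is the only multiplier between these objects. -/
def multiplier {C : Type u} [Category.{v} C] [MonoidalCategory.{v} C] [MarkovCategory C]
    (w : C) : (m : ℕ) → (w ⟶ tensorPow w m)
  | 0 => ε[w]
  | m + 1 => Δ[w] ≫ (𝟙 w ⊗ₘ multiplier w m)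

theorem isMultiplier_multiplier {C : Type u} [Category.{v} C] [MonoidalCategory.{v} C]
    [MarkovCategory C] (w : C) (m : ℕ) : IsMultiplier w (multiplier w m) := by
  induction m with
  | zero => exact .discard
  | succ m ih => exact .comp .duplicate (.tensor .identity ih)

/-! ### Anchored progressive polarized graphs, valuations, and the value of a diagram -/

/-- An anchored progressive polarized graph. `src e = none` (resp. `tgt e = none`) says that the
source (resp. target) of the edge `e` is an outer node. The inputs and outputs of every node, the
domain and the codomain are totally ordered, i.e. enumerated by lists without repetition. -/
structure AnchoredGraph where
  Node : Type
  Edge : Type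
  finite_node : Finite Node
  src : Edge → Option Node
  tgt : Edge → Option Node
  inn : Node → List Edge
  out : Node → List Edge
  dom : List Edge
  cod : List Edge
  nodup_inn : ∀ x, (inn x).Nodup
  nodup_out : ∀ x, (out x).Nodup
  nodup_dom : dom.Nodup
  nodup_cod : cod.Nodup
  mem_inn : ∀ x e, e ∈ inn x ↔ tgt e = some x
  mem_out : ∀ x e, e ∈ out x ↔ src e = some x
  mem_dom : ∀ e, e ∈ dom ↔ src e = none
  mem_cod : ∀ e, e ∈ cod ↔ tgt e = none
  progressive : ∀ x, ¬ Relation.TransGen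
    (fun y z => ∃ e, src e = some y ∧ tgt e = some z) x x

/-- A valuation of a graph in a monoidal category: objects on edges, and on every node a morphism
from the product of the values of its inputs to the product of the values of its outputs. -/
structure Valuation (Γ : AnchoredGraph) (C : Type u) [Category.{v} C]
    [MonoidalCategory.{v} C] where
  obj : Γ.Edge → C
  hom : ∀ x : Γ.Node, tensorList ((Γ.inn x).map obj) ⟶ tensorList ((Γ.out x).map obj)

/-- Ways of cutting the part of `Γ` between two levels `L` and `M` into elementary layers: each
elementary layer contains either no node and one crossing of two adjacent edges, or exactly one
node; edges running alongside are allowed on both sides. The lists are the edges cut by the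
levels, in the order in which they are lined up there. -/
inductive Layering (Γ : AnchoredGraph) :
    Set Γ.Node → List Γ.Edge → Set Γ.Node → List Γ.Edge → Type
  | refl (L : Set Γ.Node) (l : List Γ.Edge) : Layering Γ L l L l
  | swap (L : Set Γ.Node) (a b : Γ.Edge) (l : List Γ.Edge) :
      Layering Γ L (a :: b :: l) L (b :: a :: l)
  | node (L : Set Γ.Node) (x : Γ.Node) (hx : x ∉ L) (l : List Γ.Edge) :
      Layering Γ L (Γ.inn x ++ l) (insert x L) (Γ.out x ++ l)
  | wire (a : Γ.Edge) {L M : Set Γ.Node} {l m : List Γ.Edge} :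
      Layering Γ L l M m → Layering Γ L (a :: l) M (a :: m)
  | comp {L M N : Set Γ.Node} {l m n : List Γ.Edge} :
      Layering Γ L l M m → Layering Γ M m N n → Layering Γ L l N n

theorem Layering.nonempty_of_perm {Γ : AnchoredGraph} (L : Set Γ.Node) {l m : List Γ.Edge}
    (h : l.Perm m) : Nonempty (Layering Γ L l L m) := by
  induction h with
  | nil => exact ⟨.refl L []⟩
  | cons a _ ih => exact ih.map (.wire a)
  | swap a b l => exact ⟨.swap L b a l⟩
  | trans _ _ ih₁ ih₂ => exact ih₁.elim fun d => ih₂.map (.comp d)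

theorem AnchoredGraph.nonempty_layering_aux (Γ : AnchoredGraph) (k : ℕ) :
    ∀ (L : Set Γ.Node) (l : List Γ.Edge), Lᶜ.ncard = k → l.Nodup →
      (∀ e y z, Γ.src e = some y → Γ.tgt e = some z → z ∈ L → y ∈ L) →
      (∀ e, e ∈ l ↔ (∀ x, Γ.src e = some x → x ∈ L) ∧ (∀ x, Γ.tgt e = some x → x ∉ L)) →
      Nonempty (Layering Γ L l Set.univ Γ.cod) := by
  classical
  have := Γ.finite_node
  induction k with
  | zero =>
    intro L l hk hl _ hcut
    have hL : L = Set.univ := by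
      rwa [Set.ncard_eq_zero, Set.compl_empty_iff] at hk
    subst hL
    refine Layering.nonempty_of_perm _ ((List.perm_ext_iff_of_nodup hl Γ.nodup_cod).2 ?_)
    intro e
    rw [hcut, Γ.mem_cod]
    cases h : Γ.tgt e <;> simp
  | succ k ih =>
    intro L l hk hl hlow hcut
    let r : Γ.Node → Γ.Node → Prop := Relation.TransGen
      (fun y z => ∃ e, Γ.src e = some y ∧ Γ.tgt e = some z)
    have : IsTrans Γ.Node r := ⟨fun _ _ _ => Relation.TransGen.trans⟩
    have : Std.Irrefl r := ⟨Γ.progressive⟩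
    have hwf : WellFounded r := Finite.wellFounded_of_trans_of_irrefl r
    have hne : Lᶜ.Nonempty := by
      rw [Set.nonempty_iff_ne_empty]
      intro h
      simp [h] at hk
    obtain ⟨x, hx, hmin⟩ := hwf.has_min Lᶜ hne
    have hpred : ∀ e y, Γ.src e = some y → Γ.tgt e = some x → y ∈ L := by
      intro e y h1 h2
      by_contra hy
      exact hmin y hy (.single ⟨e, h1, h2⟩)
    have hxx : ∀ e, Γ.src e = some x → Γ.tgt e ≠ some x := fun e h1 h2 =>
      Γ.progressive x (.single ⟨e, h1, h2⟩)
    let rest := l.filter (fun e => e ∉ Γ.inn x)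
    have hrest : ∀ e, e ∈ rest ↔ e ∈ l ∧ Γ.tgt e ≠ some x := by
      intro e
      simp [rest, Γ.mem_inn]
    have hp : l.Perm (Γ.inn x ++ rest) := by
      refine (List.perm_ext_iff_of_nodup hl ?_).2 ?_
      · refine (Γ.nodup_inn x).append (hl.filter _) ?_
        intro e h1 h2
        exact ((hrest e).1 h2).2 ((Γ.mem_inn x e).1 h1)
      · intro e
        rw [List.mem_append, hrest, Γ.mem_inn]
        constructor
        · intro h
          by_cases h' : Γ.tgt e = some x
          · exact .inl h'
          · exact .inr ⟨h, h'⟩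
        · rintro (h | h)
          · refine (hcut e).2 ⟨fun y hy => hpred e y hy h, fun y hy => ?_⟩
            rw [h] at hy
            cases hy
            exact hx
          · exact h.1
    have hnew : Nonempty (Layering Γ (insert x L) (Γ.out x ++ rest) Set.univ Γ.cod) := by
      refine ih (insert x L) _ ?_ ?_ ?_ ?_
      · have h1 : Lᶜ = insert x (insert x L)ᶜ := by
          ext y
          by_cases h : y = x
          · subst h
            simpa using hx
          · simp [h]
        rw [h1, Set.ncard_insert_of_notMem (by simp)] at hk
        omega
      · refine (Γ.nodup_out x).append (hl.filter _) ?_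
        intro e h1 h2
        exact hx (((hcut e).1 ((hrest e).1 h2).1).1 x ((Γ.mem_out x e).1 h1))
      · intro e y z h1 h2 h3
        rcases h3 with h3 | h3
        · subst h3
          exact .inr (hpred e y h1 h2)
        · exact .inr (hlow e y z h1 h2 h3)
      · intro e
        rw [List.mem_append, hrest, Γ.mem_out, hcut]
        constructor
        · rintro (h | ⟨⟨h1, h2⟩, h3⟩)
          · refine ⟨fun y hy => ?_, fun y hy => ?_⟩
            · rw [h] at hy
              cases hy
              exact .inl rfl
            · rintro (h' | h')
              · subst h'
                exact hxx e h hy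
              · exact hx (hlow e x y h hy h')
          · refine ⟨fun y hy => .inr (h1 y hy), fun y hy => ?_⟩
            rintro (h' | h')
            · subst h'
              exact h3 hy
            · exact h2 y hy h'
        · rintro ⟨h1, h2⟩
          by_cases h : Γ.src e = some x
          · exact .inl h
          · refine .inr ⟨⟨fun y hy => ?_, fun y hy hL => h2 y hy (.inr hL)⟩,
              fun h' => h2 x h' (.inl rfl)⟩
            rcases h1 y hy with h' | h'
            · subst h'
              exact absurd hy h
            · exact h'
    obtain ⟨d₁⟩ := Layering.nonempty_of_perm L hp
    obtain ⟨d₂⟩ := hnew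
    exact ⟨.comp d₁ (.comp (.node L x hx rest) d₂)⟩

/-- Every anchored graph can be cut into elementary layers. -/
theorem AnchoredGraph.nonempty_layering (Γ : AnchoredGraph) :
    Nonempty (Layering Γ ∅ Γ.dom Set.univ Γ.cod) := by
  refine Γ.nonempty_layering_aux _ ∅ Γ.dom rfl Γ.nodup_dom (by simp) ?_
  intro e
  rw [Γ.mem_dom]
  cases h : Γ.src e <;> simp

/-- The canonical isomorphism splitting the product over a concatenation of lists of edges (an
identity in a strict monoidal category). -/
def appendIso {E : Type} {C : Type u} [Category.{v} C] [MonoidalCategory.{v} C] (f : E → C) :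
    (l m : List E) →
      (tensorList ((l ++ m).map f) ≅ tensorList (l.map f) ⊗ tensorList (m.map f))
  | [], m => (λ_ (tensorList (m.map f))).symm
  | a :: l, m => whiskerLeftIso (f a) (appendIso f l m) ≪≫
      (α_ (f a) (tensorList (l.map f)) (tensorList (m.map f))).symm

/-- The morphism obtained by composing elementary layers. -/
def Layering.eval {C : Type u} [Category.{v} C] [MonoidalCategory.{v} C] [BraidedCategory C]
    {Γ : AnchoredGraph} (V : Valuation Γ C) :
    {L M : Set Γ.Node} → {l m : List Γ.Edge} → Layering Γ L l M m →
      (tensorList (l.map V.obj) ⟶ tensorList (m.map V.obj))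
  | _, _, _, _, .refl _ _ => 𝟙 _
  | _, _, _, _, .swap _ a b l =>
      (α_ (V.obj a) (V.obj b) (tensorList (l.map V.obj))).inv ≫
        ((β_ (V.obj a) (V.obj b)).hom ▷ tensorList (l.map V.obj)) ≫
          (α_ (V.obj b) (V.obj a) (tensorList (l.map V.obj))).hom
  | _, _, _, _, .node _ x _ l =>
      (appendIso V.obj (Γ.inn x) l).hom ≫ (V.hom x ▷ tensorList (l.map V.obj)) ≫
        (appendIso V.obj (Γ.out x) l).inv
  | _, _, _, _, .wire a d => V.obj a ◁ d.eval V
  | _, _, _, _, .comp d₁ d₂ => d₁.eval V ≫ d₂.eval V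

/-- The morphism represented by an anchored diagram in a symmetric (strict) monoidal category:
cut the graph into elementary layers and compose. By the coherence of the graphical language of
symmetric monoidal categories the result does not depend on how the graph is cut. -/
def Valuation.value {C : Type u} [Category.{v} C] [MonoidalCategory.{v} C] [BraidedCategory C]
    {Γ : AnchoredGraph} (V : Valuation Γ C) :
    tensorList (Γ.dom.map V.obj) ⟶ tensorList (Γ.cod.map V.obj) :=
  (Classical.choice Γ.nonempty_layering).eval V

/-! ### The graph of a pair `(W, K)` and its subgraphs -/

/-- A directed acyclic graph on the vertices `0, …, n - 1` (the identity loops are left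
implicit), given by the sets of parents. -/
structure ParentGraph (n : ℕ) where
  parents : Fin n → Finset (Fin n)
  acyclic : ∀ i, ¬ Relation.TransGen (fun j k => j ∈ parents k) i i

namespace ParentGraph

variable {n : ℕ} (G : ParentGraph n) (S T : Finset (Fin n))

/-- There is a directed path (possibly of length `0`) in `G` from `i` to a vertex in `T`, all of
whose vertices, including `i`, lie outside `S`. -/
def ReachesAvoiding (i : Fin n) : Prop :=
  i ∉ S ∧ ∃ t ∈ T, Relation.ReflTransGen (fun j k => j ∈ G.parents k ∧ k ∉ S) i t

/-- The arrows `j → i` of the subgraph `G_{S → T}`: those lying on a directed path in `G` that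
ends in `T` and does not pass through or end in `S` (but may start in `S`). -/
def IsArrow (j i : Fin n) : Prop :=
  j ∈ G.parents i ∧ G.ReachesAvoiding S T i

/-- The vertices of the subgraph `G_{S → T}`: those in `S ∪ T` and those lying on a directed path
as above (a vertex on such a path is its end, in `T`, or the source of one of its arrows). -/
def IsVertex (i : Fin n) : Prop :=
  i ∈ S ∨ i ∈ T ∨ ∃ k, G.IsArrow S T i k

theorem ReachesAvoiding.isVertex {G : ParentGraph n} {S T : Finset (Fin n)} {i : Fin n}
    (h : G.ReachesAvoiding S T i) : G.IsVertex S T i := by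
  obtain ⟨-, t, ht, hp⟩ := h
  rcases hp.cases_head with rfl | ⟨k, hk, hp'⟩
  · exact .inr (.inl ht)
  · exact .inr (.inr ⟨k, hk.1, hk.2, t, ht, hp'⟩)

theorem IsArrow.isVertex_source {G : ParentGraph n} {S T : Finset (Fin n)} {j i : Fin n}
    (h : G.IsArrow S T j i) : G.IsVertex S T j :=
  .inr (.inr ⟨i, h⟩)

theorem IsVertex.reachesAvoiding {G : ParentGraph n} {S T : Finset (Fin n)} {i : Fin n}
    (h : G.IsVertex S T i) (hi : i ∉ S) : G.ReachesAvoiding S T i := by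
  rcases h with h | h | ⟨k, hk, hk', t, ht, hp⟩
  · exact absurd h hi
  · exact ⟨hi, i, h, .refl⟩
  · exact ⟨hi, t, ht, .head ⟨hk, hk'⟩ hp⟩

theorem IsVertex.isArrow {G : ParentGraph n} {S T : Finset (Fin n)} {i j : Fin n}
    (h : G.IsVertex S T i) (hi : i ∉ S) (hj : j ∈ G.parents i) : G.IsArrow S T j i :=
  ⟨hj, h.reachesAvoiding hi⟩

theorem isVertex_of_mem_left {i : Fin n} (h : i ∈ S) : G.IsVertex S T i :=
  .inl h

theorem isVertex_of_mem_right {i : Fin n} (h : i ∈ T) : G.IsVertex S T i :=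
  .inr (.inl h)

open Classical in
/-- The children of `j` in `G_{S → T}`. -/
def children (j : Fin n) : Finset (Fin n) :=
  Finset.univ.filter (fun i => G.IsArrow S T j i)

theorem mem_children {j i : Fin n} : i ∈ G.children S T j ↔ G.IsArrow S T j i := by
  simp [children]

/-- Nodes of the effect diagram: `mech i` carries `κ_i` (for the vertices `i ∉ S` of
`G_{S → T}`), and `mult i` carries the multiplier of the vertex `i` of `G_{S → T}`. -/
inductive EffectNode
  | mech (i : Fin n) (h : G.IsVertex S T i) (hi : i ∉ S)
  | mult (i : Fin n) (h : G.IsVertex S T i)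

/-- Edges of the effect diagram: `root i` enters the multiplier of `i`, coming from `κ_i` if
`i ∉ S` and from the domain if `i ∈ S`; `arrow j i` carries a copy of `w_j` from the multiplier of
`j` to `κ_i`; `exit t` carries the extra copy of `w_t`, for `t ∈ T`, to the codomain. -/
inductive EffectEdge
  | root (i : Fin n) (h : G.IsVertex S T i)
  | arrow (j i : Fin n) (h : G.IsArrow S T j i)
  | exit (t : Fin n) (h : t ∈ T)

variable {S T}

/-- Source of an edge of the effect diagram. -/
def effectSrc : G.EffectEdge S T → Option (G.EffectNode S T)
  | .root i h => if hi : i ∈ S then none else some (.mech i h hi)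
  | .arrow j _ h => some (.mult j h.isVertex_source)
  | .exit t h => some (.mult t (G.isVertex_of_mem_right S T h))

/-- Target of an edge of the effect diagram. -/
def effectTgt : G.EffectEdge S T → Option (G.EffectNode S T)
  | .root i h => some (.mult i h)
  | .arrow _ i h => some (.mech i h.2.isVertex h.2.1)
  | .exit _ _ => none

/-- Inputs of a node of the effect diagram, in the given order. -/
def effectInn : G.EffectNode S T → List (G.EffectEdge S T)
  | .mech i h hi => (G.parents i).sort.pmap (fun j hj => .arrow j i hj)
      (fun _ hj => h.isArrow hi ((Finset.mem_sort _).1 hj))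
  | .mult i h => [.root i h]

/-- Outputs of a node of the effect diagram: from the multiplier of `i` there is one edge to each
child of `i` in `G_{S → T}`, followed by an extra one if `i ∈ T`. -/
def effectOut : G.EffectNode S T → List (G.EffectEdge S T)
  | .mech i h _ => [.root i h]
  | .mult i _ => (G.children S T i).sort.pmap (fun k hk => .arrow i k hk)
      (fun _ hk => (G.mem_children S T).1 ((Finset.mem_sort _).1 hk)) ++
        (if hi : i ∈ T then [.exit i hi] else [])

/-- The vertex of `G` to which a node of the effect diagram belongs. -/
def nodeVertex : G.EffectNode S T → Fin n
  | .mech i _ _ => i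
  | .mult i _ => i

theorem effect_progressive (x : G.EffectNode S T) : ¬ Relation.TransGen
    (fun y z => ∃ e, G.effectSrc e = some y ∧ G.effectTgt e = some z) x x := by
  let R : G.EffectNode S T → G.EffectNode S T → Prop := fun y z =>
    Relation.TransGen (fun j k => j ∈ G.parents k) (G.nodeVertex y) (G.nodeVertex z) ∨
      (G.nodeVertex y = G.nodeVertex z ∧ (∃ i h hi, y = .mech i h hi) ∧ ∃ i h, z = .mult i h)
  have key : ∀ y z, Relation.TransGen
      (fun y z => ∃ e, G.effectSrc e = some y ∧ G.effectTgt e = some z) y z → R y z := by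
    intro y z h
    have step : ∀ y z, (∃ e, G.effectSrc e = some y ∧ G.effectTgt e = some z) → R y z := by
      rintro y z ⟨e, h1, h2⟩
      cases e with
      | root i h =>
        by_cases hi : i ∈ S
        · simp [effectSrc, hi] at h1
        · simp only [effectSrc, hi, dite_false, Option.some.injEq] at h1
          simp only [effectTgt, Option.some.injEq] at h2
          subst h1 h2
          exact .inr ⟨rfl, ⟨i, h, hi, rfl⟩, i, h, rfl⟩
      | arrow j i h =>
        simp only [effectSrc, Option.some.injEq] at h1
        simp only [effectTgt, Option.some.injEq] at h2
        subst h1 h2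
        exact .inl (.single h.1)
      | exit t h => simp [effectTgt] at h2
    induction h with
    | single h => exact step _ _ h
    | tail _ h ih =>
      rcases ih with ih | ⟨ih, -, i, hi, rfl⟩
      · rcases step _ _ h with h' | ⟨h', -⟩
        · exact .inl (ih.trans h')
        · exact .inl (h' ▸ ih)
      · rcases step _ _ h with h' | ⟨-, ⟨_, _, _, h'⟩, -⟩
        · exact .inl (ih ▸ h')
        · cases h'
  intro h
  rcases key x x h with h' | ⟨-, ⟨_, _, _, rfl⟩, _, _, h'⟩
  · exact G.acyclic _ h'
  · cases h'

instance : Finite (G.EffectNode S T) := by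
  refine Finite.of_injective (β := Fin n × Bool)
    (fun x => match x with
      | .mech i _ _ => (i, true)
      | .mult i _ => (i, false)) ?_
  intro x y h
  cases x <;> cases y <;> simp_all

variable (S T)

/-- The graph underlying the effect diagram: its components (`κ_i`, if `i ∉ S`, followed by the
multiplier of `i`) are fused along the edges `arrow j i`; the domain is enumerated by `S` and the
codomain by `T`, in increasing order. -/
def effectGraph : AnchoredGraph where
  Node := G.EffectNode S T
  Edge := G.EffectEdge S T
  finite_node := inferInstance
  src := G.effectSrc
  tgt := G.effectTgt
  inn := G.effectInn
  out := G.effectOut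
  dom := S.sort.pmap (fun i hi => .root i hi) 
    (fun _ hi => G.isVertex_of_mem_left S T ((Finset.mem_sort _).1 hi))
  cod := T.sort.pmap (fun t ht => .exit t ht) (fun _ ht => (Finset.mem_sort _).1 ht)
  nodup_inn x := by
    cases x with
    | mech i h hi =>
      refine List.Nodup.pmap ?_ (Finset.sort_nodup _ _)
      intro a _ b _ hab
      cases hab
      rfl
    | mult i h => simp [effectInn]
  nodup_out x := by
    cases x with
    | mech i h hi => simp [effectOut]
    | mult i h =>
      refine List.Nodup.append (List.Nodup.pmap ?_ (Finset.sort_nodup _ _)) ?_ ?_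
      · intro a _ b _ hab
        cases hab
        rfl
      · split <;> simp
      · intro e h1 h2
        rw [List.mem_pmap] at h1
        obtain ⟨k, hk, rfl⟩ := h1
        split at h2 <;> simp at h2
  nodup_dom := by
    refine List.Nodup.pmap ?_ (Finset.sort_nodup _ _)
    intro a _ b _ hab
    cases hab
    rfl
  nodup_cod := by
    refine List.Nodup.pmap ?_ (Finset.sort_nodup _ _)
    intro a _ b _ hab
    cases hab
    rfl
  mem_inn x e := by
    cases x with
    | mech i h hi =>
      cases e with
      | arrow j k hk =>
        simp only [effectInn, effectTgt, List.mem_pmap, Option.some.injEq,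
          EffectNode.mech.injEq, EffectEdge.arrow.injEq, Finset.mem_sort]
        constructor
        · rintro ⟨a, _, h1, h2⟩
          exact h2.symm
        · rintro rfl
          exact ⟨j, hk.1, rfl, rfl⟩
      | _ => simp [effectInn, effectTgt]
    | mult i h =>
      cases e <;> simp [effectInn, effectTgt]
  mem_out x e := by
    cases x with
    | mech i h hi =>
      cases e with
      | root k hk =>
        by_cases hkS : k ∈ S
        · simp only [effectOut, effectSrc, hkS, List.mem_singleton, EffectEdge.root.injEq]
          constructor
          · rintro rfl
            exact absurd hkS hi
          · intro h'
            simp at h'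
        · simp [effectOut, effectSrc, hkS]
      | _ => simp [effectOut, effectSrc]
    | mult i h =>
      cases e with
      | root k hk =>
        simp only [effectOut, effectSrc, List.mem_append, List.mem_pmap]
        by_cases hkS : k ∈ S <;> by_cases hiT : i ∈ T <;> simp [hkS, hiT]
      | arrow j k hk =>
        simp only [effectOut, effectSrc, List.mem_append, List.mem_pmap]
        constructor
        · rintro (⟨a, ha, h1⟩ | h1)
          · cases h1
            rfl
          · split at h1 <;> simp at h1
        · intro h1
          simp only [Option.some.injEq, EffectNode.mult.injEq] at h1
          subst h1
          exact .inl ⟨k, (Finset.mem_sort _).2 ((G.mem_children S T).2 hk), rfl⟩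
      | exit t ht =>
        simp only [effectOut, effectSrc, List.mem_append, List.mem_pmap]
        constructor
        · rintro (⟨a, ha, h1⟩ | h1)
          · cases h1
          · split at h1
            · simp only [List.mem_singleton, EffectEdge.exit.injEq] at h1
              subst h1
              rfl
            · simp at h1
        · intro h1
          simp only [Option.some.injEq, EffectNode.mult.injEq] at h1
          cases h1
          right
          simp [ht]
  mem_dom e := by
    cases e with
    | root i h => by_cases hi : i ∈ S <;> simp [effectSrc, hi]
    | arrow j i h => simp [effectSrc]
    | exit t h => simp [effectSrc]
  mem_cod e := by
    cases e with
    | root i h => simp [effectTgt]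
    | arrow j i h => simp [effectTgt]
    | exit t h => simpa [effectTgt] using h
  progressive := G.effect_progressive

end ParentGraph

/-! ### Effects -/

/-- A pair `(W, K)`: a sequence `W` of `n` objects `w_i` and a family `K` of morphisms
`κ_i : w_{S_i} ⟶ w_i`, where `S_i` is the set of parents of `i` in a directed acyclic graph and
`w_{S_i}` is the monoidal product of the `w_j`, `j ∈ S_i`, in increasing order. -/
structure EffectData (C : Type u) [Category.{v} C] [MonoidalCategory.{v} C] (n : ℕ) extends
    ParentGraph n where
  obj : Fin n → C
  κ : ∀ i : Fin n, tensorList ((parents i).sort.map obj) ⟶ obj i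

namespace EffectData

section

variable {C : Type u} [Category.{v} C] [MonoidalCategory.{v} C] {n : ℕ} (D : EffectData C n)

/-- The object `w_S`: the monoidal product of the `w_i`, `i ∈ S`, in increasing order. -/
def prodObj (S : Finset (Fin n)) : C :=
  tensorList (S.sort.map D.obj)

variable {S T : Finset (Fin n)}

/-- The object on an edge of the effect diagram. -/
def edgeObj : D.EffectEdge S T → C
  | .root i _ => D.obj i
  | .arrow j _ _ => D.obj j
  | .exit t _ => D.obj t

/-- The number of copies of `w_i` produced by the multiplier of `i`: the number of children of `i`
in `G_{S → T}`, plus one if `i ∈ T`. -/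
def copies (S T : Finset (Fin n)) (i : Fin n) : ℕ :=
  (D.children S T i).card + if i ∈ T then 1 else 0

theorem map_inn_mech (i : Fin n) (h : D.IsVertex S T i) (hi : i ∉ S) :
    (D.effectInn (.mech i h hi)).map D.edgeObj = (D.parents i).sort.map D.obj := by
  simp [ParentGraph.effectInn, List.map_pmap, edgeObj]

theorem map_out_mult (i : Fin n) (h : D.IsVertex S T i) :
    (D.effectOut (.mult i h)).map D.edgeObj = List.replicate (D.copies S T i) (D.obj i) := by
  rw [List.eq_replicate_iff]
  constructor
  · by_cases hi : i ∈ T <;> simp [ParentGraph.effectOut, copies, hi]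
  · intro b hb
    rw [List.mem_map] at hb
    obtain ⟨e, he, rfl⟩ := hb
    by_cases hi : i ∈ T
    · simp only [ParentGraph.effectOut, hi, dite_true, List.mem_append, List.mem_pmap,
        List.mem_singleton] at he
      rcases he with ⟨k, hk, rfl⟩ | rfl <;> rfl
    · simp only [ParentGraph.effectOut, hi, dite_false, List.append_nil, List.mem_pmap] at he
      obtain ⟨k, hk, rfl⟩ := he
      rfl

theorem map_dom :
    (D.effectGraph S T).dom.map D.edgeObj = S.sort.map D.obj := by
  simp [ParentGraph.effectGraph, List.map_pmap, edgeObj]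

theorem map_cod :
    (D.effectGraph S T).cod.map D.edgeObj = T.sort.map D.obj := by
  simp [ParentGraph.effectGraph, List.map_pmap, edgeObj]

end

section

variable {C : Type u} [Category.{v} C] [MonoidalCategory.{v} C] [MarkovCategory C] {n : ℕ}
  (D : EffectData C n) (S T : Finset (Fin n))

/-- The morphism on a node of the effect diagram: `κ_i` on `mech i` and the multiplier
`w_i ⟶ w_i ⊗ ⋯ ⊗ w_i` on `mult i`. The unitors and the `eqToHom`s only account for the one-element
lists of edges and for the relabelling of lists. -/
def nodeHom : ∀ x : D.EffectNode S T, tensorList ((D.effectInn x).map D.edgeObj) ⟶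
    tensorList ((D.effectOut x).map D.edgeObj)
  | .mech i h hi => eqToHom (congrArg tensorList (D.map_inn_mech i h hi)) ≫ D.κ i ≫
      (ρ_ (D.obj i)).inv
  | .mult i h => (ρ_ (D.obj i)).hom ≫ multiplier (D.obj i) (D.copies S T i) ≫
      eqToHom (congrArg tensorList (D.map_out_mult i h).symm)

/-- The effect diagram. -/
def effectDiagram : Valuation (D.effectGraph S T) C where
  obj := D.edgeObj
  hom := D.nodeHom S T

/-- The `(W, K)`-effect of `w_S` on `w_T`, written `[T ‖ S]`: the morphism `w_S ⟶ w_T` represented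
by the effect diagram. -/
def effect : D.prodObj S ⟶ D.prodObj T :=
  eqToHom (congrArg tensorList D.map_dom.symm) ≫ (D.effectDiagram S T).value ≫
    eqToHom (congrArg tensorList D.map_cod)

end

end EffectData

/-! ### Images under strict Markov functors -/

section

variable {C : Type u₁} [Category.{v₁} C] [MonoidalCategory.{v₁} C] [MarkovCategory C]
  {E : Type u₂} [Category.{v₂} E] [MonoidalCategory.{v₂} E] [MarkovCategory E]
  {F : C ⥤ E} [F.Braided]

theorem IsStrictMarkovFunctor.obj_tensorList (hF : IsStrictMarkovFunctor F) {ι : Type}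
    (w : ι → C) (l : List ι) :
    F.obj (tensorList (l.map w)) = tensorList (l.map fun i => F.obj (w i)) := by
  induction l with
  | nil => exact hF.obj_unit
  | cons a l ih => exact (hF.obj_tensor _ _).trans (congrArg (F.obj (w a) ⊗ ·) ih)

/-- The pair `(F(W), F(K))`: the objects `F(w_i)` and the morphisms `F(κ_i)`, over the same
directed acyclic graph. -/
def EffectData.map {n : ℕ} (D : EffectData C n) (hF : IsStrictMarkovFunctor F) :
    EffectData E n where
  toParentGraph := D.toParentGraph
  obj i := F.obj (D.obj i)
  κ i := eqToHom (hF.obj_tensorList D.obj _).symm ≫ F.map (D.κ i)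

theorem EffectData.obj_prodObj {n : ℕ} (D : EffectData C n) (hF : IsStrictMarkovFunctor F)
    (S : Finset (Fin n)) : F.obj (D.prodObj S) = (D.map hF).prodObj S :=
  hF.obj_tensorList D.obj _

end

end MarkovEffect

end

namespace MarkovEffect

/-! ### Lax braided functors and layered diagrams -/

section Comparison

open Functor.LaxMonoidal (μ μ_natural_right associativity_inv)

variable {C : Type u₁} [Category.{v₁} C] [MonoidalCategory.{v₁} C]
  {E : Type u₂} [Category.{v₂} E] [MonoidalCategory.{v₂} E] (F : C ⥤ E)

/-! The value of a diagram is a composite of elementary layers, built by whiskering from symmetries,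
coherence isomorphisms and the morphisms on the nodes. A braided functor respects all of these up to
its structure morphisms, so by induction on the layering it carries the value of a diagram to the
value of the image diagram (`Layering.eval_compareList`). The layering is chosen from the graph
alone, and `EffectData.map` keeps the graph, so both sides of the theorem are evaluated along the
same layering and independence of that choice is not needed.

The induction is done for lax braided functors and an arbitrary family of comparison morphisms on
the edges, where the bookkeeping is ordinary naturality. Only afterwards are the comparisons
specialised to `eqToHom`s: for a strict Markov functor the assembled comparison `compareList` is
then an `eqToHom` too (`IsStrictMarkovFunctor.compareList_eq`). It remains to check the nodes: the
mechanisms match by definition of the image pair, and the multipliers because duplicates and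
discards are preserved (`IsStrictMarkovFunctor.map_multiplier`). -/

theorem associator_inv_tensorHom_μ [F.LaxMonoidal] {X Y Z : C} {X' Y' Z' : E}
    (p : X' ⟶ F.obj X) (q : Y' ⟶ F.obj Y) (r : Z' ⟶ F.obj Z) :
    (α_ X' Y' Z').inv ≫ ((p ⊗ₘ q) ≫ μ F X Y ⊗ₘ r) ≫ μ F (X ⊗ Y) Z =
      (p ⊗ₘ (q ⊗ₘ r) ≫ μ F Y Z) ≫ μ F X (Y ⊗ Z) ≫ F.map (α_ X Y Z).inv := by
  -- Separating `p`, `q`, `r` from `μ` leaves the associativity axiom of `μ` and the naturality of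
  -- the associator.
  have h₁ : ((p ⊗ₘ q) ≫ μ F X Y ⊗ₘ r) = ((p ⊗ₘ q) ⊗ₘ r) ≫ (μ F X Y ▷ F.obj Z) := by
    rw [← MonoidalCategory.tensorHom_id, MonoidalCategory.tensorHom_comp_tensorHom,
      Category.comp_id]
  have h₂ : (p ⊗ₘ (q ⊗ₘ r) ≫ μ F Y Z) = (p ⊗ₘ (q ⊗ₘ r)) ≫ (F.obj X ◁ μ F Y Z) := by
    rw [← MonoidalCategory.id_tensorHom, MonoidalCategory.tensorHom_comp_tensorHom,
      Category.comp_id]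
  rw [h₁, h₂, Category.assoc, Category.assoc, associativity_inv,
    MonoidalCategory.associator_inv_naturality_assoc]

theorem associator_hom_tensorHom_μ [F.LaxMonoidal] {X Y Z : C} {X' Y' Z' : E}
    (p : X' ⟶ F.obj X) (q : Y' ⟶ F.obj Y) (r : Z' ⟶ F.obj Z) :
    (α_ X' Y' Z').hom ≫ (p ⊗ₘ (q ⊗ₘ r) ≫ μ F Y Z) ≫ μ F X (Y ⊗ Z) =
      ((p ⊗ₘ q) ≫ μ F X Y ⊗ₘ r) ≫ μ F (X ⊗ Y) Z ≫ F.map (α_ X Y Z).hom := by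
  rw [← cancel_epi (α_ X' Y' Z').inv, reassoc_of% (associator_inv_tensorHom_μ F p q r)]
  simp [← F.map_comp]

/-- The structure morphism of a lax monoidal functor on the product of a list of objects, combined
with given comparisons on the factors. -/
def compareList [F.LaxMonoidal] {ι : Type} {f : ι → C} {g : ι → E}
    (φ : ∀ i, g i ⟶ F.obj (f i)) :
    (l : List ι) → (tensorList (l.map g) ⟶ F.obj (tensorList (l.map f)))
  | [] => Functor.LaxMonoidal.ε F
  | a :: l => (φ a ⊗ₘ compareList φ l) ≫ μ F (f a) (tensorList (l.map f))

/-- Comparisons are compatible with concatenation: unitality of `F` gives the empty list,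
associativity of `μ` the induction step. This lets a node act on an initial segment of the edges at
a level. -/
theorem appendIso_hom_compareList [F.LaxMonoidal] {ι : Type} {f : ι → C} {g : ι → E}
    (φ : ∀ i, g i ⟶ F.obj (f i)) (l m : List ι) :
    (appendIso g l m).hom ≫ (compareList F φ l ⊗ₘ compareList F φ m) ≫ μ F _ _ =
      compareList F φ (l ++ m) ≫ F.map (appendIso f l m).hom := by
  induction l with
  | nil =>
    change (λ_ (tensorList (m.map g))).inv ≫
        (Functor.LaxMonoidal.ε F ⊗ₘ compareList F φ m) ≫ μ F _ _ =
      compareList F φ m ≫ F.map (λ_ (tensorList (m.map f))).inv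
    rw [Functor.LaxMonoidal.ε_tensorHom_comp_μ,
      ← MonoidalCategory.leftUnitor_inv_naturality_assoc]
    simp
  | cons a l ih =>
    change (g a ◁ (appendIso g l m).hom ≫ (α_ _ _ _).inv) ≫
        (((φ a ⊗ₘ compareList F φ l) ≫ μ F _ _) ⊗ₘ compareList F φ m) ≫ μ F _ _ =
      ((φ a ⊗ₘ compareList F φ (l ++ m)) ≫ μ F _ _) ≫
        F.map (f a ◁ (appendIso f l m).hom ≫ (α_ _ _ _).inv)
    rw [F.map_comp, Category.assoc, Category.assoc, associator_inv_tensorHom_μ,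
      ← Functor.LaxMonoidal.μ_natural_right_assoc, ← MonoidalCategory.id_tensorHom, ← MonoidalCategory.id_tensorHom,
      MonoidalCategory.tensorHom_comp_tensorHom_assoc,
      MonoidalCategory.tensorHom_comp_tensorHom_assoc, ih, Category.id_comp, Category.comp_id]

theorem appendIso_inv_compareList [F.LaxMonoidal] {ι : Type} {f : ι → C} {g : ι → E}
    (φ : ∀ i, g i ⟶ F.obj (f i)) (l m : List ι) :
    (appendIso g l m).inv ≫ compareList F φ (l ++ m) =
      (compareList F φ l ⊗ₘ compareList F φ m) ≫ μ F _ _ ≫ F.map (appendIso f l m).inv := by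
  rw [Iso.inv_comp_eq, reassoc_of% (appendIso_hom_compareList F φ l m), ← F.map_comp,
    Iso.hom_inv_id, F.map_id, Category.comp_id]

/-- Lax braided functors are compatible with the evaluation of any layering. -/
theorem Layering.eval_compareList [BraidedCategory C] [BraidedCategory E] [F.LaxBraided]
    {Γ : AnchoredGraph} (V : Valuation Γ C) (V' : Valuation Γ E)
    (φ : ∀ e, V'.obj e ⟶ F.obj (V.obj e))
    (hφ : ∀ x, V'.hom x ≫ compareList F φ (Γ.out x) =
      compareList F φ (Γ.inn x) ≫ F.map (V.hom x))
    {L M : Set Γ.Node} {l m : List Γ.Edge} (d : Layering Γ L l M m) :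
    d.eval V' ≫ compareList F φ m = compareList F φ l ≫ F.map (d.eval V) := by
  induction d with
  | refl L l => simp [Layering.eval]
  | swap L a b l =>
    change ((α_ _ _ _).inv ≫ (β_ _ _).hom ▷ _ ≫ (α_ _ _ _).hom) ≫
        (φ b ⊗ₘ (φ a ⊗ₘ compareList F φ l) ≫ μ F _ _) ≫ μ F _ _ =
      ((φ a ⊗ₘ (φ b ⊗ₘ compareList F φ l) ≫ μ F _ _) ≫ μ F _ _) ≫
        F.map ((α_ _ _ _).inv ≫ (β_ _ _).hom ▷ _ ≫ (α_ _ _ _).hom)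
    -- The crossing alone, without the edges alongside: the braiding axiom of `F` together with
    -- naturality of the braiding in the two comparisons. Regrouping with `μ` then extends it to the
    -- whole layer.
    have h : (β_ (V'.obj a) (V'.obj b)).hom ≫ (φ b ⊗ₘ φ a) ≫ μ F _ _ =
        ((φ a ⊗ₘ φ b) ≫ μ F _ _) ≫ F.map (β_ (V.obj a) (V.obj b)).hom := by
      rw [Category.assoc, Functor.LaxBraided.braided,
        BraidedCategory.braiding_naturality_assoc]
    rw [Category.assoc, Category.assoc, associator_hom_tensorHom_μ,
      ← MonoidalCategory.tensorHom_id, MonoidalCategory.tensorHom_comp_tensorHom_assoc, h,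
      F.map_comp, F.map_comp, Category.assoc, Category.assoc,
      ← reassoc_of% (associator_inv_tensorHom_μ F (φ a) (φ b) (compareList F φ l)),
      ← Functor.LaxMonoidal.μ_natural_left_assoc, ← MonoidalCategory.tensorHom_id,
      MonoidalCategory.tensorHom_comp_tensorHom_assoc, Category.id_comp, Category.comp_id,
      Category.assoc]
  | node L x hx l =>
    -- The inputs and outputs of the node are split off, and naturality of `μ` reduces the layer to
    -- `hφ x`.
    simp only [Layering.eval, Category.assoc, appendIso_inv_compareList, F.map_comp]
    rw [← reassoc_of% (appendIso_hom_compareList F φ (Γ.inn x) l), ← Functor.LaxMonoidal.μ_natural_left_assoc,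
      ← MonoidalCategory.tensorHom_id, ← MonoidalCategory.tensorHom_id,
      MonoidalCategory.tensorHom_comp_tensorHom_assoc,
      MonoidalCategory.tensorHom_comp_tensorHom_assoc, hφ, Category.id_comp, Category.comp_id]
  | wire a d ih =>
    change (V'.obj a ◁ d.eval V') ≫ ((φ a ⊗ₘ _) ≫ μ F _ _) = ((φ a ⊗ₘ _) ≫ μ F _ _) ≫
      F.map (V.obj a ◁ d.eval V)
    rw [Category.assoc, ← μ_natural_right, ← MonoidalCategory.id_tensorHom,
      ← MonoidalCategory.id_tensorHom, MonoidalCategory.tensorHom_comp_tensorHom_assoc,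
      MonoidalCategory.tensorHom_comp_tensorHom_assoc, ih, Category.id_comp, Category.comp_id]
  | comp d₁ d₂ ih₁ ih₂ =>
    simp only [Layering.eval, Category.assoc, F.map_comp, ih₂, reassoc_of% ih₁]

end Comparison

/-! ### Strict Markov functors: comparisons become equalities of objects -/

section

/-- The endpoints are free variables so that `subst` can remove the relabellings; the concrete
products over lists are not variables and could not be substituted. -/
theorem map_eqToHom_comp_comp_eqToHom {C : Type u₁} [Category.{v₁} C] {E : Type u₂}
    [Category.{v₂} E] (F : C ⥤ E) {X X' Y Y' : C} {A A' B B' : E} {f : X' ⟶ Y'} {g : A' ⟶ B'}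
    {hA : F.obj X' = A'} {hB : B' = F.obj Y'} (h : F.map f = eqToHom hA ≫ g ≫ eqToHom hB)
    (h₁ : X = X') (h₂ : Y' = Y) (h₃ : F.obj X = A) (h₄ : A = A') (h₅ : B' = B)
    (h₆ : B = F.obj Y) :
    F.map (eqToHom h₁ ≫ f ≫ eqToHom h₂) =
      eqToHom h₃ ≫ (eqToHom h₄ ≫ g ≫ eqToHom h₅) ≫ eqToHom h₆ := by
  subst h₁ h₂ h₄ h₅
  simpa using h

theorem eqToHom_tensorHom_eqToHom {C : Type u} [Category.{v} C] [MonoidalCategory.{v} C]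
    {X X' Y Y' : C} (h : X = X') (k : Y = Y') :
    (eqToHom h ⊗ₘ eqToHom k) = eqToHom (by rw [h, k]) := by
  subst h k
  simp

variable {C : Type u₁} [Category.{v₁} C] [MonoidalCategory.{v₁} C] [MarkovCategory C]
  {E : Type u₂} [Category.{v₂} E] [MonoidalCategory.{v₂} E] [MarkovCategory E]
  {F : C ⥤ E} [F.Braided]

namespace IsStrictMarkovFunctor

theorem compareList_eq (hF : IsStrictMarkovFunctor F) {ι : Type} {f : ι → C} {g : ι → E}
    (h : ∀ i, g i = F.obj (f i)) (l : List ι) (hl : tensorList (l.map g) =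
      F.obj (tensorList (l.map f))) :
    compareList F (fun i => eqToHom (h i)) l = eqToHom hl := by
  -- Replacing `g` turns every comparison on a single factor into an identity, so only `ε` and `μ`
  -- contribute, and both are `eqToHom`s.
  obtain rfl : g = fun i => F.obj (f i) := funext h
  induction l with
  | nil => exact hF.ε_eq
  | cons a l ih =>
    simp only [compareList]
    rw [ih (hF.obj_tensorList f l).symm, hF.μ_eq, eqToHom_tensorHom_eqToHom]
    exact eqToHom_trans _ _

theorem obj_tensorPow (hF : IsStrictMarkovFunctor F) (w : C) (m : ℕ) :
    F.obj (tensorPow w m) = tensorPow (F.obj w) m := by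
  -- The power is the product of a constant family over a list of `m` copies of `()`.
  simpa [tensorPow] using hF.obj_tensorList (fun _ : Unit => w) (List.replicate m ())

/-- Preservation of discards starts the induction. In the step, preservation of duplicates produces
a `μ`, and naturality of `μ` brings the tensor factor, hence the shorter multiplier, into reach. -/
theorem map_multiplier (hF : IsStrictMarkovFunctor F) (w : C) (m : ℕ) :
    F.map (multiplier w m) = multiplier (F.obj w) m ≫ eqToHom (hF.obj_tensorPow w m).symm := by
  induction m with
  | zero =>
    change F.map ε[w] = ε[F.obj w] ≫ _
    rw [← hF.map_discard, hF.ε_eq]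
    rfl
  | succ m ih =>
    change F.map (Δ[w] ≫ (𝟙 w ⊗ₘ multiplier w m)) =
      (Δ[F.obj w] ≫ (𝟙 _ ⊗ₘ multiplier (F.obj w) m)) ≫ _
    have h : (𝟙 (F.obj w) ⊗ₘ multiplier (F.obj w) m ≫ eqToHom (hF.obj_tensorPow w m).symm) =
        (𝟙 _ ⊗ₘ multiplier (F.obj w) m) ≫
          (eqToHom rfl ⊗ₘ eqToHom (hF.obj_tensorPow w m).symm) := by
      rw [MonoidalCategory.tensorHom_comp_tensorHom, eqToHom_refl, Category.comp_id]
    rw [F.map_comp, ← hF.map_copy, Category.assoc, ← Functor.LaxMonoidal.μ_natural, ih, hF.μ_eq,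
      F.map_id, h, eqToHom_tensorHom_eqToHom]
    simp only [Category.assoc]
    rw [eqToHom_trans]
    exact (Category.assoc _ _ _).symm

theorem obj_tensorList_map (hF : IsStrictMarkovFunctor F) {ι : Type} {f : ι → C} {g : ι → E}
    (h : ∀ i, g i = F.obj (f i)) (l : List ι) :
    tensorList (l.map g) = F.obj (tensorList (l.map f)) := by
  obtain rfl : g = fun i => F.obj (f i) := funext h
  exact (hF.obj_tensorList f l).symm

/-- Strict Markov functors preserve the values of diagrams. -/
theorem map_value (hF : IsStrictMarkovFunctor F) {Γ : AnchoredGraph} (V : Valuation Γ C)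
    (V' : Valuation Γ E) (h : ∀ e, V'.obj e = F.obj (V.obj e))
    (hom : ∀ x, V'.hom x ≫ eqToHom (hF.obj_tensorList_map h (Γ.out x)) =
      eqToHom (hF.obj_tensorList_map h (Γ.inn x)) ≫ F.map (V.hom x)) :
    F.map V.value = eqToHom (hF.obj_tensorList_map h Γ.dom).symm ≫ V'.value ≫
      eqToHom (hF.obj_tensorList_map h Γ.cod) := by
  -- The chosen layering depends only on `Γ`, so the same term occurs in `V.value` and in
  -- `V'.value`.
  have key := Layering.eval_compareList F V V' (fun e => eqToHom (h e))
    (fun x => by simpa only [hF.compareList_eq h _ (hF.obj_tensorList_map h _)] using hom x)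
    (Classical.choice Γ.nonempty_layering)
  rw [hF.compareList_eq h _ (hF.obj_tensorList_map h _),
    hF.compareList_eq h _ (hF.obj_tensorList_map h _)] at key
  rw [Valuation.value, Valuation.value, key]
  simp

/-! ### The effect diagram of the image pair -/

/-- The effect diagram of `(F(W), F(K))`, as a valuation of the effect graph of `(W, K)`. -/
noncomputable def mapDiagram (hF : IsStrictMarkovFunctor F) {n : ℕ} (D : EffectData C n)
    (S T : Finset (Fin n)) : Valuation (D.effectGraph S T) E :=
  (D.map hF).effectDiagram S T

theorem mapDiagram_obj (hF : IsStrictMarkovFunctor F) {n : ℕ} (D : EffectData C n)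
    (S T : Finset (Fin n)) (e : (D.effectGraph S T).Edge) :
    (hF.mapDiagram D S T).obj e = F.obj ((D.effectDiagram S T).obj e) := by
  -- `edgeObj` is defined by matching on the edge, so the two objects agree by computation only once
  -- the kind of edge is known.
  cases e <;> rfl

/-- The unitors enter because a one-element list of edges has product `X ⊗ 𝟙_ C`. This is the right
unitality of `F` with `μ` and `ε` replaced by `eqToHom`s. -/
theorem map_rightUnitor_inv (hF : IsStrictMarkovFunctor F) (X : C) :
    F.map (ρ_ X).inv = (ρ_ (F.obj X)).inv ≫
      eqToHom ((hF.obj_tensor X (𝟙_ C)).trans (congrArg (F.obj X ⊗ ·) hF.obj_unit)).symm := by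
  have h : F.obj X ◁ eqToHom hF.obj_unit.symm =
      eqToHom (congrArg (F.obj X ⊗ ·) hF.obj_unit.symm) := by
    rw [← MonoidalCategory.id_tensorHom, ← eqToHom_refl (F.obj X) rfl, eqToHom_tensorHom_eqToHom]
  rw [← Functor.LaxMonoidal.right_unitality_inv, hF.μ_eq, hF.ε_eq, h, eqToHom_trans]

theorem map_rightUnitor_hom (hF : IsStrictMarkovFunctor F) (X : C) :
    F.map (ρ_ X).hom = eqToHom ((hF.obj_tensor X (𝟙_ C)).trans
      (congrArg (F.obj X ⊗ ·) hF.obj_unit)) ≫ (ρ_ (F.obj X)).hom := by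
  rw [← cancel_epi (F.map (ρ_ X).inv), ← F.map_comp, Iso.inv_hom_id, F.map_id,
    hF.map_rightUnitor_inv]
  simp

/-- The node condition for a mechanism. `P` stands for the product over the parents, `P'` for the
product over the incoming edges, `Q` and `Q'` for their counterparts in `E`; as variables they can
be substituted away, which leaves only the unitor. -/
theorem mechanism_comp_eqToHom (hF : IsStrictMarkovFunctor F) {P P' w : C} {Q Q' : E}
    (κ : P ⟶ w) (h₁ : Q' = Q) (h₂ : Q = F.obj P) (h₃ : F.obj w ⊗ 𝟙_ E = F.obj (w ⊗ 𝟙_ C))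
    (h₄ : Q' = F.obj P') (h₅ : P' = P) :
    (eqToHom h₁ ≫ (eqToHom h₂ ≫ F.map κ) ≫ (ρ_ (F.obj w)).inv) ≫ eqToHom h₃ =
      eqToHom h₄ ≫ F.map (eqToHom h₅ ≫ κ ≫ (ρ_ w).inv) := by
  subst h₅ h₁ h₂
  rw [eqToHom_refl, eqToHom_refl, Category.id_comp, Category.id_comp,
    Category.id_comp, Category.id_comp, F.map_comp, hF.map_rightUnitor_inv, Category.assoc]

/-- The node condition for a multiplier, with `P` and `Q` standing for the products over the
outgoing edges. -/
theorem multiplier_comp_eqToHom (hF : IsStrictMarkovFunctor F) (w : C) (m : ℕ) {P : C} {Q : E}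
    (h₁ : tensorPow (F.obj w) m = Q) (h₂ : Q = F.obj P)
    (h₃ : F.obj w ⊗ 𝟙_ E = F.obj (w ⊗ 𝟙_ C)) (h₄ : tensorPow w m = P) :
    ((ρ_ (F.obj w)).hom ≫ multiplier (F.obj w) m ≫ eqToHom h₁) ≫ eqToHom h₂ =
      eqToHom h₃ ≫ F.map ((ρ_ w).hom ≫ multiplier w m ≫ eqToHom h₄) := by
  subst h₄ h₁
  rw [eqToHom_refl, eqToHom_refl, Category.comp_id, Category.comp_id, F.map_comp,
    hF.map_rightUnitor_hom, hF.map_multiplier, Category.assoc, Category.assoc,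
    eqToHom_trans_assoc, eqToHom_refl, Category.id_comp]

theorem mapDiagram_hom (hF : IsStrictMarkovFunctor F) {n : ℕ} (D : EffectData C n)
    (S T : Finset (Fin n)) (x : (D.effectGraph S T).Node) :
    (hF.mapDiagram D S T).hom x ≫
        eqToHom (hF.obj_tensorList_map (hF.mapDiagram_obj D S T) ((D.effectGraph S T).out x)) =
      eqToHom (hF.obj_tensorList_map (hF.mapDiagram_obj D S T) ((D.effectGraph S T).inn x)) ≫
        F.map ((D.effectDiagram S T).hom x) := by
  cases x with
  | mech i h hi => exact hF.mechanism_comp_eqToHom (D.κ i) _ _ _ _ _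
  | mult i h => exact hF.multiplier_comp_eqToHom (D.obj i) (D.copies S T i) _ _ _ _

end IsStrictMarkovFunctor

end

end MarkovEffect

theorem proposition5p1
    {M : Type u₁} [Category.{v₁} M] [MonoidalCategory.{v₁} M] [MarkovCategory M]
    {N : Type u₂} [Category.{v₂} N] [MonoidalCategory.{v₂} N] [MarkovCategory N]
    (hM : MarkovEffect.IsStraight M) (hN : MarkovEffect.IsStraight N)
    (F : M ⥤ N) [F.Braided] (hF : MarkovEffect.IsStrictMarkovFunctor F)
    {n : ℕ} (D : MarkovEffect.EffectData M n) (hD : ∀ i, D.obj i ≠ 𝟙_ M)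
    (S T : Finset (Fin n)) :
    F.map (D.effect S T) =
      eqToHom (D.obj_prodObj hF S) ≫ (D.map hF).effect S T ≫
        eqToHom (D.obj_prodObj hF T).symm := by
  -- On both sides `effect` unfolds to a `value` between two relabellings, and `map_value` compares
  -- the two values.
  exact MarkovEffect.map_eqToHom_comp_comp_eqToHom F
    (hF.map_value _ _ (hF.mapDiagram_obj D S T) (hF.mapDiagram_hom D S T)) _ _ _
    (congrArg _ (D.map hF).map_dom.symm) (congrArg _ (D.map hF).map_cod) _
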